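/- Let $\mathbb{F}_q$ be a finite field with $q$ odd, and let $\widehat{\mathbb{F}_q^\times}$ be the group of characters $\chi:\mathbb{F}_q^\times\to\mathbb{C}^\times$, each extended to $\mathbb{F}_q$ by $\chi(0)=0$ (including the trivial character). Write $\overline{\chi}=\chi^{-1}$, let $\phi$ be the quadratic character, and let $\delta(0)=1$ and $\delta(x)=0$ for $x\in\mathbb{F}_q^\times$. For characters $A,B,A_1,A_2,B_1$ and $\lambda\in\mathbb{F}_q$ put $$J(A,B)=\sum_{y\in\mathbb{F}_q}A(y)B(1-y),$$ $${}_2\mathbb{F}_1\left[\begin{matrix}A_1&A_2\\&B_1\end{matrix};\lambda\right]=\frac{1}{J(A_2,B_1\overline{A_2})}\sum_{y\in\mathbb{F}_q}A_2(y)\,\overline{A_2}B_1(1-y)\,\overline{A_1}(1-\lambda y).$$ Let $B,D\in\widehat{\mathbb{F}_q^\times}$ and set $C=D^2$. If $D\neq\phi$ and $B\neq D$, then for all $x\in\mathbb{F}_q$ $$\overline{C}(1-x)\;{}_2\mathbb{F}_1\left[\begin{matrix}D\phi\overline{B}&D\\&C\overline{B}\end{matrix};\frac{-4x}{(1-x)^2}\right]={}_2\mathbb{F}_1\left[\begin{matrix}B&C\\&C\overline{B}\end{matrix};x\right]-\delta(1-x)\frac{J(C,\overline{B}^2)}{J(C,\overline{B})}-\delta(1+x)\frac{J(\overline{B},D\phi)}{J(C,\overline{B})},$$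 where for $x=1$ the left-hand side is understood to be $0$, because of the factor $\overline{C}(0)=0$. -/

import Mathlib

noncomputable section

namespace FFHyp

variable {F : Type*} [Field F] [Fintype F]

/-- The quadratic character of a finite field, with complex values. -/
def phi (F : Type*) [Field F] [Fintype F] [DecidableEq F] : MulChar F ℂ :=
  (quadraticChar F).ringHomComp (Int.castRingHom ℂ)

/-- The indicator function of `0` on the field, with complex values. -/
def delta [DecidableEq F] (x : F) : ℂ := if x = 0 then 1 else 0

/-- The period function `₁ℙ₀[A; x] = A⁻¹(1 - x)`. -/
def P10 (A : MulChar F ℂ) (x : F) : ℂ := A⁻¹ (1 - x)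

/-- The period function `₂ℙ₁[A₁, A₂; B₁; lam]`. -/
def P21 (A₁ A₂ B₁ : MulChar F ℂ) (lam : F) : ℂ :=
  ∑ y : F, A₂ y * (A₂⁻¹ * B₁) (1 - y) * P10 A₁ (lam * y)

/-- The normalized hypergeometric function `₂𝔽₁[A₁, A₂; B₁; lam]`. The Jacobi sum in the
denominator never vanishes when the field has more than two elements. -/
def F21 (A₁ A₂ B₁ : MulChar F ℂ) (lam : F) : ℂ :=
  1 / jacobiSum A₂ (B₁ * A₂⁻¹) * P21 A₁ A₂ B₁ lam

end FFHyp

end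

/-! ### Values of characters and the multiplicative Fourier transform -/

noncomputable section

namespace FFHyp

variable {F : Type*} [Field F]

/-! Clear the Jacobi-sum normalizations and compare the Mellin transforms in x of both sides at
every character η; this settles x ≠ 0, and at x = 0 both sides are 1.

Pfaff's transformation (`P21_pfaff_quadratic`) first replaces the argument -4x/(1-x)² by 4x/(1+x)²,
with boundary corrections at x = ±1. The transform of the new left side is a sum over χ of products
of three Jacobi sums. In Gauss sums, the factors g(Dχ)g(φDχ) become g((Dχ)²)g(φ) by Hasse–Davenport,
and g((Dχ)²) cancels g((Dχ)⁻²) by reflection. Four Gauss sums depending on χ remain, and Barnes'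
first lemma (`sum_gaussSum_mul`) sums them to the transform of the right-hand ₂ℙ₁.

Reflection fails when (Dχ)² = 1, that is, for χ = D⁻¹ and χ = φD⁻¹. The first defect cancels Pfaff's
correction at x = -1, the second is the δ(1+x) term, and Pfaff's correction at x = 1 is the δ(1-x)
term. -/

theorem inv_apply_mul_apply (χ : MulChar F ℂ) {a : F} (ha : a ≠ 0) : χ⁻¹ a * χ a = 1 := by
  rw [← MulChar.mul_apply, inv_mul_cancel, MulChar.one_apply ha.isUnit]

theorem apply_ne_zero (χ : MulChar F ℂ) {a : F} (ha : a ≠ 0) : χ a ≠ 0 :=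
  MulChar.apply_ne_zero_iff.mpr ha.isUnit

theorem apply_div (χ : MulChar F ℂ) (a b : F) : χ (a / b) = χ a * (χ b)⁻¹ := by
  rw [div_eq_mul_inv, map_mul, ← MulChar.inv_apply', MulChar.inv_apply_eq_inv']

theorem apply_neg_one_sq (χ : MulChar F ℂ) : χ (-1) * χ (-1) = 1 := by
  rw [← map_mul]; simp

theorem apply_neg_one_eq (χ : MulChar F ℂ) : χ (-1) = 1 ∨ χ (-1) = -1 :=
  mul_self_eq_one_iff.mp (apply_neg_one_sq χ)

theorem inv_apply_neg_one (χ : MulChar F ℂ) : χ⁻¹ (-1) = χ (-1) := by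
  rw [MulChar.inv_apply']; simp

theorem four_ne_zero_of_ringChar (hF : ringChar F ≠ 2) : (4 : F) ≠ 0 := by
  have h : (4 : F) = 2 * 2 := by norm_num
  rw [h]
  exact mul_ne_zero (Ring.two_ne_zero hF) (Ring.two_ne_zero hF)

variable [Fintype F]

/-- The finite group of complex characters, as a `Fintype`. -/
instance fintypeMulChar : Fintype (MulChar F ℂ) := Fintype.ofFinite _

/-! ### Orthogonality and the multiplicative Fourier transform -/

theorem card_units_cast [DecidableEq F] :
    (Fintype.card Fˣ : ℂ) = (Fintype.card F : ℂ) - 1 := by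
  rw [Fintype.card_eq_card_units_add_one (α := F)]
  push_cast
  ring

theorem card_sub_one_ne_zero : (Fintype.card F : ℂ) - 1 ≠ 0 := by
  have h : 1 < Fintype.card F := Fintype.one_lt_card
  rw [sub_ne_zero]
  exact_mod_cast h.ne'

theorem card_cast_ne_zero : (Fintype.card F : ℂ) ≠ 0 := by
  exact_mod_cast Fintype.card_ne_zero

theorem card_ne_two (hF : ringChar F ≠ 2) : (Fintype.card F : ℂ) ≠ 2 := by
  intro h
  have h2 : Fintype.card F = 2 := by exact_mod_cast h
  have := FiniteField.odd_card_of_char_ne_two hF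
  omega

theorem sum_mulChar [DecidableEq (MulChar F ℂ)] (χ : MulChar F ℂ) :
    ∑ x, χ x = if χ = 1 then (Fintype.card F : ℂ) - 1 else 0 := by
  classical
  split_ifs with h
  · rw [h, MulChar.sum_one_eq_card_units, card_units_cast]
  · exact MulChar.sum_eq_zero_of_ne_one h

theorem sum_mulChar_apply [DecidableEq F] (a : F) :
    ∑ χ : MulChar F ℂ, χ a = if a = 1 then (Fintype.card F : ℂ) - 1 else 0 := by
  split_ifs with h
  · subst h
    simp only [MulChar.map_one, Finset.sum_const, Finset.card_univ, nsmul_eq_mul, mul_one]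
    rw [← Nat.card_eq_fintype_card, MulChar.card_eq_card_units_of_hasEnoughRootsOfUnity,
      Nat.card_eq_fintype_card, card_units_cast]
  · obtain ⟨χ, hχ⟩ := MulChar.exists_apply_ne_one_of_hasEnoughRootsOfUnity F ℂ h
    refine eq_zero_of_mul_eq_self_left hχ ?_
    simp only [Finset.mul_sum, ← MulChar.mul_apply]
    exact Fintype.sum_bijective _ (Group.mulLeft_bijective χ) _ _ fun χ' ↦ rfl

/-- Inversion formula for the multiplicative Fourier transform on a finite field. -/
theorem mellin_inversion (h : F → ℂ) {x : F} (hx : x ≠ 0) :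
    ∑ χ : MulChar F ℂ, χ x * ∑ y, χ⁻¹ y * h y = ((Fintype.card F : ℂ) - 1) * h x := by
  classical
  simp_rw [Finset.mul_sum]
  rw [Finset.sum_comm]
  have key (y : F) : ∑ χ : MulChar F ℂ, χ x * (χ⁻¹ y * h y) =
      if y = x then ((Fintype.card F : ℂ) - 1) * h y else 0 := by
    simp_rw [← mul_assoc, MulChar.inv_apply', ← map_mul]
    rw [← Finset.sum_mul, sum_mulChar_apply]
    by_cases hy : y = 0
    · subst hy
      simp [hx.symm]
    · have : x * y⁻¹ = 1 ↔ y = x := by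
        rw [mul_inv_eq_one₀ hy, eq_comm]
      simp [this]
  simp [key]

/-- Characters vanish at 0, so the transform does not see the value there; x = 0 needs a separate
check. -/
theorem eq_zero_of_mellin_eq_zero (h : F → ℂ)
    (hh : ∀ χ : MulChar F ℂ, ∑ y, χ⁻¹ y * h y = 0) {x : F} (hx : x ≠ 0) : h x = 0 := by
  have := mellin_inversion h hx
  simp only [hh, mul_zero, Finset.sum_const_zero] at this
  exact (mul_eq_zero.mp this.symm).resolve_left card_sub_one_ne_zero

/-! ### The quadratic character -/

section Quadratic

variable [DecidableEq F]

theorem phi_mul_self : phi F * phi F = 1 := by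
  have h : (phi F).IsQuadratic := (quadraticChar_isQuadratic F).comp _
  rw [← sq, h.sq_eq_one]

theorem phi_inv : (phi F)⁻¹ = phi F := inv_eq_of_mul_eq_one_left phi_mul_self

theorem phi_ne_one (hF : ringChar F ≠ 2) : phi F ≠ 1 :=
  (MulChar.ringHomComp_ne_one_iff Int.cast_injective).mpr (quadraticChar_ne_one hF)

/-- A character is determined by its value at a generator of the cyclic group Fˣ. If its square is
trivial this value is ±1, and φ takes the value -1. -/
theorem mulChar_sq_eq_one_iff (hF : ringChar F ≠ 2) {χ : MulChar F ℂ} :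
    χ ^ 2 = 1 ↔ χ = 1 ∨ χ = phi F := by
  constructor
  · intro h
    obtain ⟨g, hg⟩ := IsCyclic.exists_generator (α := Fˣ)
    have val (η : MulChar F ℂ) (hη : η ^ 2 = 1) : η g = 1 ∨ η g = -1 := by
      rw [← mul_self_eq_one_iff, ← MulChar.mul_apply, ← sq, hη, MulChar.one_apply_coe]
    have hphi : phi F g = -1 := by
      refine (val _ (by rw [sq, phi_mul_self])).resolve_left fun h1 ↦ phi_ne_one hF ?_
      rw [MulChar.eq_iff hg, h1, MulChar.one_apply_coe]
    rcases val χ h with h1 | h1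
    · left
      rw [MulChar.eq_iff hg, h1, MulChar.one_apply_coe]
    · right
      rw [MulChar.eq_iff hg, h1, hphi]
  · rintro (rfl | rfl)
    · simp
    · rw [sq, phi_mul_self]

theorem phi_apply_sq {a : F} (ha : a ≠ 0) : phi F (a ^ 2) = 1 := by
  rw [map_pow, ← MulChar.pow_apply' _ two_ne_zero, sq, phi_mul_self, MulChar.one_apply ha.isUnit]

/-- A sum over squares, weighted by the number of square roots. -/
theorem sum_comp_sq (hF : ringChar F ≠ 2) (f : F → ℂ) :
    ∑ v : F, f (v ^ 2) = ∑ u : F, (1 + phi F u) * f u := by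
  have key (u : F) : (1 + phi F u) = ∑ v : F, if v ^ 2 = u then (1 : ℂ) else 0 := by
    have h := quadraticChar_card_sqrts hF u
    rw [Finset.sum_boole]
    have h2 : ((Finset.univ.filter fun v : F ↦ v ^ 2 = u).card : ℤ) = quadraticChar F u + 1 := by
      rw [← h]
      congr 2
      ext v; simp
    have h3 : phi F u = ((quadraticChar F u : ℤ) : ℂ) := rfl
    rw [h3, add_comm]
    exact_mod_cast h2.symm
  simp_rw [key, Finset.sum_mul]
  rw [Finset.sum_comm]
  simp

/-- The substitution u = (1+v)/2 turns u(1-u) into (1-v²)/4. Counting square roots gives the weight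
1 + φ, whose constant part contributes nothing because χ is nontrivial. -/
theorem jacobiSum_self (hF : ringChar F ≠ 2) {χ : MulChar F ℂ} (hχ : χ ≠ 1) :
    jacobiSum χ χ = χ⁻¹ 4 * jacobiSum (phi F) χ := by
  have h2 : (2 : F) ≠ 0 := Ring.two_ne_zero hF
  have h4 := four_ne_zero_of_ringChar hF
  have hsum : ∑ u : F, χ (1 - u) = 0 := by
    rw [← MulChar.sum_eq_zero_of_ne_one hχ]
    exact (Equiv.subLeft (1 : F)).sum_comp (fun u ↦ χ u)
  have h1 : jacobiSum χ χ = ∑ v : F, χ⁻¹ 4 * χ (1 - v ^ 2) := by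
    rw [jacobiSum]
    refine (Fintype.sum_equiv ((Equiv.addLeft (1 : F)).trans (Equiv.mulRight₀ (2 : F)⁻¹
      (inv_ne_zero h2))) _ _ fun v ↦ ?_).symm
    rw [MulChar.inv_apply', ← map_mul, ← map_mul]
    congr 1
    simp only [Equiv.trans_apply, Equiv.coe_addLeft, Equiv.mulRight₀_apply]
    field_simp
    ring
  rw [h1, ← Finset.mul_sum, sum_comp_sq hF (fun u ↦ χ (1 - u))]
  simp_rw [add_mul, one_mul]
  rw [Finset.sum_add_distrib, hsum, zero_add, jacobiSum]

end Quadratic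

end FFHyp

/-! ### Gauss sums: reflection, Jacobi sums, duplication -/

namespace FFHyp

variable {F : Type*} [Field F] [Fintype F]

theorem exists_primitive_addChar : ∃ ψ : AddChar F ℂ, ψ.IsPrimitive := by
  obtain ⟨ψ, hψ⟩ := AddChar.exists_apply_ne_zero.mpr (one_ne_zero (α := F))
  refine ⟨ψ, AddChar.IsPrimitive.of_ne_one ?_⟩
  rintro rfl
  simp at hψ

variable {ψ : AddChar F ℂ}

theorem gaussSum_one (hψ : ψ.IsPrimitive) : gaussSum (1 : MulChar F ℂ) ψ = -1 :=
  gaussSum_one_left (by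
    rintro rfl
    exact hψ one_ne_zero (by ext; simp))

theorem gaussSum_mul_inv (hψ : ψ.IsPrimitive) {χ : MulChar F ℂ} (hχ : χ ≠ 1) :
    gaussSum χ ψ * gaussSum χ⁻¹ ψ = Fintype.card F * χ (-1) := by
  rw [← gaussSum_mul_gaussSum_eq_card hχ hψ, ← mul_gaussSum_inv_eq_gaussSum χ⁻¹ ψ,
    inv_apply_neg_one]
  ring

theorem gaussSum_ne_zero (hψ : ψ.IsPrimitive) (χ : MulChar F ℂ) : gaussSum χ ψ ≠ 0 := by
  by_cases h : χ = 1
  · rw [h, gaussSum_one hψ]; simp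
  · exact gaussSum_ne_zero_of_nontrivial card_cast_ne_zero h hψ

/-- The Jacobi sum as a symmetric product of three Gauss sums. -/
theorem card_mul_jacobiSum (hψ : ψ.IsPrimitive) {a b c : MulChar F ℂ} (habc : a * b * c = 1)
    (hab : ¬(a = 1 ∧ b = 1)) :
    Fintype.card F * jacobiSum a b = c (-1) * gaussSum a ψ * gaussSum b ψ * gaussSum c ψ := by
  have hc : c = (a * b)⁻¹ := (inv_eq_of_mul_eq_one_right habc).symm
  by_cases h : a * b = 1
  · have hb : b = a⁻¹ := (inv_eq_of_mul_eq_one_right h).symm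
    have ha : a ≠ 1 := fun ha ↦ hab ⟨ha, by rw [hb, ha, inv_one]⟩
    have hc1 : c = 1 := by rw [hc, h, inv_one]
    have := gaussSum_mul_inv hψ ha
    rw [hc1, hb, jacobiSum_nontrivial_inv ha, gaussSum_one hψ, MulChar.one_apply (by simp)]
    linear_combination this
  · have h1 := jacobiSum_mul_nontrivial h ψ
    have h2 := gaussSum_mul_inv hψ h
    have h3 := apply_neg_one_sq (a * b)
    rw [← hc] at h2
    have h4 : c (-1) = (a * b) (-1) := by rw [hc, inv_apply_neg_one]
    rw [h4]
    linear_combination (a * b) (-1) * gaussSum c ψ * h1 - (a * b) (-1) * jacobiSum a b * h2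
      - Fintype.card F * jacobiSum a b * h3

/-- By the three-Gauss-sum formula J is a product of nonzero factors over q, except J(1,1) = q - 2.
This permits clearing the normalizations. -/
theorem jacobiSum_ne_zero (hq : (Fintype.card F : ℂ) ≠ 2) (a b : MulChar F ℂ) :
    jacobiSum a b ≠ 0 := by
  by_cases h : a = 1 ∧ b = 1
  · rw [h.1, h.2, jacobiSum_one_one]
    exact sub_ne_zero.mpr hq
  · obtain ⟨ψ, hψ⟩ := exists_primitive_addChar (F := F)
    refine right_ne_zero_of_mul (a := (Fintype.card F : ℂ)) ?_
    rw [card_mul_jacobiSum hψ (mul_inv_cancel (a * b)) h]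
    exact mul_ne_zero (mul_ne_zero (mul_ne_zero (apply_ne_zero _ (by simp))
      (gaussSum_ne_zero hψ _)) (gaussSum_ne_zero hψ _)) (gaussSum_ne_zero hψ _)

/-- The Hasse–Davenport duplication formula. -/
theorem gaussSum_duplication [DecidableEq F] (hF : ringChar F ≠ 2) (hψ : ψ.IsPrimitive)
    (χ : MulChar F ℂ) :
    χ 4 * (gaussSum χ ψ * gaussSum (phi F * χ) ψ) =
      gaussSum (χ ^ 2) ψ * gaussSum (phi F) ψ := by
  have h4 := four_ne_zero_of_ringChar hF
  by_cases h : χ ^ 2 = 1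
  · have h44 : χ 4 = 1 := by
      have : (4 : F) = 2 ^ 2 := by norm_num
      rw [this, map_pow, ← MulChar.pow_apply' _ two_ne_zero, h,
        MulChar.one_apply (Ring.two_ne_zero hF).isUnit]
    rcases (mulChar_sq_eq_one_iff hF).mp h with rfl | rfl
    · rw [h44, mul_one, one_pow, one_mul]
    · rw [h44, h, phi_mul_self]
      ring
  · have hχ1 : χ ≠ 1 := fun h' ↦ h (by rw [h', one_pow])
    have hχφ : phi F * χ ≠ 1 := fun h' ↦ by
      have : χ = phi F := by rw [← phi_inv]; exact (inv_eq_of_mul_eq_one_right h').symm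
      exact h (by rw [this, sq, phi_mul_self])
    have h1 := jacobiSum_mul_nontrivial (sq χ ▸ h) ψ
    have h2 := jacobiSum_mul_nontrivial hχφ ψ
    have h3 := jacobiSum_self hF hχ1
    have h5 := inv_apply_mul_apply χ h4
    rw [← sq] at h1
    -- For χ² ≠ 1, the formula is J(χ,χ) = χ⁻¹(4) J(φ,χ) written in Gauss sums.
    refine mul_left_cancel₀ (gaussSum_ne_zero hψ χ) ?_
    linear_combination - χ 4 * gaussSum (phi F * χ) ψ * h1 + gaussSum (χ ^ 2) ψ * h2 +
      gaussSum (χ ^ 2) ψ * gaussSum (phi F * χ) ψ * χ 4 * h3 +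
      gaussSum (χ ^ 2) ψ * gaussSum (phi F * χ) ψ * jacobiSum (phi F) χ * h5

end FFHyp

namespace FFHyp

variable {F : Type*} [Field F] [Fintype F]

/-! ### The first Barnes lemma for Gauss sums -/

/-- For r ≠ 0 rescale s; for r = 0 use orthogonality. Since χ⁻¹(0) = 0, one formula covers both. -/
theorem sum_mul_addChar_mul [DecidableEq (MulChar F ℂ)] [DecidableEq F] (ψ : AddChar F ℂ)
    (χ : MulChar F ℂ) (r : F) :
    ∑ s, χ s * ψ (s * r) =
      χ⁻¹ r * gaussSum χ ψ + if r = 0 ∧ χ = 1 then (Fintype.card F : ℂ) - 1 else 0 := by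
  by_cases hr : r = 0
  · simp [hr, sum_mulChar, MulChar.map_zero]
  · have h := gaussSum_mulShift_eq χ ψ (Units.mk0 r hr)
    simp only [gaussSum, AddChar.mulShift_apply, Units.val_mk0] at h
    simp only [hr, false_and, if_false, add_zero, gaussSum]
    simp_rw [← h, mul_comm r]

/-- Put t = sk in the double sum. With a, c twisted by χ, χ⁻¹ the product ac is unchanged, so the
right side is a Mellin transform in k. -/
theorem gaussSum_mul_gaussSum (ψ : AddChar F ℂ) (a c : MulChar F ℂ) :
    gaussSum a ψ * gaussSum c ψ = ∑ k, c k * ∑ s, (a * c) s * ψ (s * (1 + k)) := by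
  rw [gaussSum, gaussSum, Finset.sum_mul_sum]
  simp_rw [Finset.mul_sum]
  rw [Finset.sum_comm (s := Finset.univ) (t := Finset.univ) (f := fun k s ↦ c k * _)]
  refine Finset.sum_congr rfl fun s _ ↦ ?_
  by_cases hs : s = 0
  · simp [hs, MulChar.map_zero]
  · rw [← Equiv.sum_comp (Equiv.mulLeft₀ s hs)]
    refine Finset.sum_congr rfl fun k _ ↦ ?_
    rw [Equiv.mulLeft₀_apply, mul_add, mul_one, AddChar.map_add_eq_mul, map_mul,
      MulChar.mul_apply]
    ring

/-- The finite field analogue of Barnes' first lemma. -/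
theorem sum_gaussSum_mul [DecidableEq (MulChar F ℂ)] (ψ : AddChar F ℂ) (a b c d : MulChar F ℂ) :
    ∑ χ : MulChar F ℂ, gaussSum (a * χ) ψ * gaussSum (c * χ⁻¹) ψ *
        (gaussSum (d * χ⁻¹) ψ * gaussSum (b * χ) ψ) =
      ((Fintype.card F : ℂ) - 1) * (b * c) (-1) *
        (jacobiSum (b * c) (a * b * c * d)⁻¹ * gaussSum (a * c) ψ * gaussSum (b * d) ψ +
          if a * c = 1 ∧ b * d = 1 then ((Fintype.card F : ℂ) - 1) ^ 2 else 0) := by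
  classical
  have e1 (χ : MulChar F ℂ) : a * χ * (c * χ⁻¹) = a * c := by
    rw [mul_mul_mul_comm, mul_inv_cancel, mul_one]
  have e2 (χ : MulChar F ℂ) : d * χ⁻¹ * (b * χ) = b * d := by
    rw [mul_mul_mul_comm, inv_mul_cancel, mul_one, mul_comm]
  set G : MulChar F ℂ → F → ℂ := fun m k ↦ ∑ s, m s * ψ (s * (1 + k)) with hG
  have h1 : ∑ χ : MulChar F ℂ, gaussSum (a * χ) ψ * gaussSum (c * χ⁻¹) ψ *
        (gaussSum (d * χ⁻¹) ψ * gaussSum (b * χ) ψ) =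
      ∑ k, b k * G (b * d) k * ∑ χ : MulChar F ℂ, χ k * ∑ y, χ⁻¹ y * (c y * G (a * c) y) := by
    simp_rw [gaussSum_mul_gaussSum, e1, e2,
      Finset.mul_sum (s := (Finset.univ : Finset (MulChar F ℂ)))]
    rw [Finset.sum_comm]
    refine Finset.sum_congr rfl fun χ _ ↦ ?_
    rw [Finset.mul_sum]
    refine Finset.sum_congr rfl fun k _ ↦ ?_
    have : ∑ y, (c * χ⁻¹) y * ∑ s, (a * c) s * ψ (s * (1 + y)) =
        ∑ y, χ⁻¹ y * (c y * G (a * c) y) := by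
      refine Finset.sum_congr rfl fun y _ ↦ ?_
      rw [MulChar.mul_apply, hG]
      ring
    rw [this, MulChar.mul_apply]
    ring
  -- After inversion, the two inner sums are multiplied at the same k. Both degenerate at k = -1,
  -- the source of the exceptional (q-1)² term.
  have h2 (k : F) : b k * G (b * d) k *
        ∑ χ : MulChar F ℂ, χ k * ∑ y, χ⁻¹ y * (c y * G (a * c) y) =
      ((Fintype.card F : ℂ) - 1) * (gaussSum (a * c) ψ * gaussSum (b * d) ψ *
        ((b * c) k * (a * b * c * d)⁻¹ (1 + k)) +
        if k = -1 then (b * c) (-1) *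
          (if a * c = 1 ∧ b * d = 1 then ((Fintype.card F : ℂ) - 1) ^ 2 else 0) else 0) := by
    by_cases hk : k = 0
    · simp [hk, MulChar.map_zero]
    rw [mellin_inversion _ hk]
    simp only [hG, sum_mul_addChar_mul]
    have e3 : a * b * c * d = (a * c) * (b * d) := by
      rw [mul_right_comm a b c, mul_assoc]
    by_cases hk1 : k = -1
    · subst hk1
      by_cases h1 : a * c = 1 <;> by_cases h2 : b * d = 1 <;> simp [h1, h2, MulChar.map_zero]
      ring
    · have : 1 + k ≠ 0 := fun h ↦ hk1 (eq_neg_of_add_eq_zero_right h)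
      simp only [this, false_and, if_false, add_zero, hk1, e3, mul_inv, MulChar.mul_apply]
      ring
  rw [h1]
  simp_rw [h2]
  rw [← Finset.mul_sum, Finset.sum_add_distrib, Finset.sum_ite_eq', if_pos (Finset.mem_univ _),
    ← Finset.mul_sum]
  have h3 : ∑ k, (b * c) k * (a * b * c * d)⁻¹ (1 + k) =
      (b * c) (-1) * jacobiSum (b * c) (a * b * c * d)⁻¹ := by
    rw [jacobiSum, Finset.mul_sum, ← Equiv.sum_comp (Equiv.neg F)]
    refine Finset.sum_congr rfl fun k _ ↦ ?_
    rw [← mul_assoc, ← map_mul, Equiv.neg_apply, neg_one_mul, sub_eq_add_neg]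
  rw [h3]
  ring

/-! ### The period function `₂ℙ₁` -/

theorem mellin_comp_mul (χ : MulChar F ℂ) (f : F → ℂ) {y : F} (hy : y ≠ 0) :
    ∑ l, χ⁻¹ l * f (l * y) = χ y * ∑ m, χ⁻¹ m * f m := by
  rw [Finset.mul_sum, ← Equiv.sum_comp (Equiv.mulRight₀ y hy) (fun m ↦ χ y * (χ⁻¹ m * f m))]
  refine Finset.sum_congr rfl fun l _ ↦ ?_
  rw [Equiv.mulRight₀_apply, map_mul]
  linear_combination - χ⁻¹ l * f (l * y) * inv_apply_mul_apply χ hy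

/-- The multiplicative Fourier transform of `₂ℙ₁`. -/
theorem mellin_P21 (A₁ A₂ B₁ χ : MulChar F ℂ) :
    ∑ l, χ⁻¹ l * P21 A₁ A₂ B₁ l = jacobiSum χ⁻¹ A₁⁻¹ * jacobiSum (A₂ * χ) (A₂⁻¹ * B₁) := by
  simp_rw [P21, Finset.mul_sum]
  rw [Finset.sum_comm, jacobiSum, jacobiSum, Finset.mul_sum]
  refine Finset.sum_congr rfl fun y _ ↦ ?_
  by_cases hy : y = 0
  · simp [hy, MulChar.map_zero]
  have h := mellin_comp_mul χ (fun m ↦ A₁⁻¹ (1 - m)) hy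
  rw [MulChar.mul_apply A₂ χ]
  calc _ = A₂ y * (A₂⁻¹ * B₁) (1 - y) * ∑ l, χ⁻¹ l * A₁⁻¹ (1 - l * y) := by
        rw [Finset.mul_sum]
        exact Finset.sum_congr rfl fun l _ ↦ by rw [P10]; ring
    _ = _ := by rw [h]; ring

theorem P21_zero (A₁ A₂ B₁ : MulChar F ℂ) : P21 A₁ A₂ B₁ 0 = jacobiSum A₂ (A₂⁻¹ * B₁) := by
  simp [P21, P10, jacobiSum]

theorem P21_one (A₁ A₂ B₁ : MulChar F ℂ) :
    P21 A₁ A₂ B₁ 1 = jacobiSum A₂ (A₂⁻¹ * B₁ * A₁⁻¹) := by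
  simp [P21, P10, jacobiSum, MulChar.mul_apply, mul_assoc]

/-- Pfaff's transformation. -/
theorem P21_pfaff (A₁ A₂ B₁ : MulChar F ℂ) {l : F} (hl : l ≠ 1) :
    P21 A₁ A₂ B₁ l = A₂⁻¹ (1 - l) * P21 (B₁ * A₁⁻¹) A₂ B₁ (l / (l - 1)) := by
  classical
  have hl1 : 1 - l ≠ 0 := sub_ne_zero.mpr hl.symm
  have hl2 : l - 1 ≠ 0 := sub_ne_zero.mpr hl
  have hmu (z : F) : 1 - l / (l - 1) * z = (1 - l + l * z) / (1 - l) := by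
    field_simp
    ring
  simp only [P21, P10, Finset.mul_sum, hmu]
  -- Discard the poles of y ↦ y(1-l)/(1-ly) and of its inverse, where the summands vanish; the map
  -- is then a bijection of what is left.
  rw [← Finset.sum_filter_of_ne (p := fun y : F ↦ 1 - l * y ≠ 0)
    (fun y _ h h0 ↦ h (by simp [h0, MulChar.map_zero])),
    ← Finset.sum_filter_of_ne (s := Finset.univ) (p := fun z : F ↦ 1 - l + l * z ≠ 0)
    (fun y _ h h0 ↦ h (by simp [h0, MulChar.map_zero]))]
  refine Finset.sum_nbij' (fun y ↦ y * (1 - l) / (1 - l * y)) (fun z ↦ z / (1 - l + l * z))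
    ?_ ?_ ?_ ?_ ?_
  · intro y hy
    simp only [Finset.mem_filter, Finset.mem_univ, true_and] at hy ⊢
    have : 1 - l + l * (y * (1 - l) / (1 - l * y)) = (1 - l) / (1 - l * y) := by
      field_simp
      ring
    rw [this]
    exact div_ne_zero hl1 hy
  · intro z hz
    simp only [Finset.mem_filter, Finset.mem_univ, true_and] at hz ⊢
    have : 1 - l * (z / (1 - l + l * z)) = (1 - l) / (1 - l + l * z) := by
      field_simp
      ring
    rw [this]
    exact div_ne_zero hl1 hz
  · intro y hy
    simp only [Finset.mem_filter, Finset.mem_univ, true_and] at hy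
    have : 1 - l + l * (y * (1 - l) / (1 - l * y)) = (1 - l) / (1 - l * y) := by
      field_simp
      ring
    have hy' : 1 - y * l ≠ 0 := by rwa [mul_comm]
    simp only [this]
    field_simp
  · intro z hz
    simp only [Finset.mem_filter, Finset.mem_univ, true_and] at hz
    have : 1 - l * (z / (1 - l + l * z)) = (1 - l) / (1 - l + l * z) := by
      field_simp
      ring
    have hz' : 1 - l + z * l ≠ 0 := by rwa [mul_comm z]
    simp only [this]
    field_simp
  · intro y hy
    simp only [Finset.mem_filter, Finset.mem_univ, true_and] at hy
    have h1 : (1 - l + l * (y * (1 - l) / (1 - l * y))) / (1 - l) = 1 / (1 - l * y) := by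
      field_simp
      ring
    have h2 : 1 - y * (1 - l) / (1 - l * y) = (1 - y) / (1 - l * y) := by
      rw [eq_div_iff hy, sub_mul, div_mul_cancel₀ _ hy]
      ring
    have n1 := apply_ne_zero A₁ hy
    have n2 := apply_ne_zero A₂ hy
    have n3 := apply_ne_zero B₁ hy
    have n4 := apply_ne_zero A₂ hl1
    rw [h1, h2]
    simp only [MulChar.mul_apply, MulChar.inv_apply_eq_inv', apply_div, map_mul, MulChar.map_one,
      one_mul, inv_inv, mul_inv]
    generalize 1 - l * y = r at *
    field_simp

/-- The multiplicative Fourier transform along `x ↦ 4x/(1+x)²`. -/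
theorem mellin_comp_quadratic (hF : ringChar F ≠ 2) (η C : MulChar F ℂ) (h : F → ℂ) :
    ((Fintype.card F : ℂ) - 1) *
        ∑ x, η⁻¹ x * (C⁻¹ (1 + x) * h (4 * x / (1 + x) ^ 2)) =
      ∑ χ : MulChar F ℂ, (∑ y, χ⁻¹ y * h y) *
        (χ 4 * (η * χ) (-1) * jacobiSum (η⁻¹ * χ) (C⁻¹ * (χ⁻¹) ^ 2)) := by
  have h4 := four_ne_zero_of_ringChar hF
  have h1 (x : F) : ((Fintype.card F : ℂ) - 1) *
      (η⁻¹ x * (C⁻¹ (1 + x) * h (4 * x / (1 + x) ^ 2))) =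
      ∑ χ : MulChar F ℂ, (∑ y, χ⁻¹ y * h y) *
        (χ 4 * ((η⁻¹ * χ) x * (C⁻¹ * (χ⁻¹) ^ 2) (1 + x))) := by
    -- Inversion needs a nonzero argument. At x = 0 and x = -1 both sides vanish, so nothing is
    -- lost.
    by_cases hx : x = 0
    · simp [hx, MulChar.map_zero]
    by_cases hx1 : 1 + x = 0
    · simp [hx1, MulChar.map_zero]
    have hm : 4 * x / (1 + x) ^ 2 ≠ 0 := div_ne_zero (mul_ne_zero h4 hx) (pow_ne_zero _ hx1)
    have := mellin_inversion h hm
    calc _ = (η⁻¹ x * C⁻¹ (1 + x)) * (((Fintype.card F : ℂ) - 1) * h (4 * x / (1 + x) ^ 2)) := by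
          ring
      _ = _ := by
        rw [← this, Finset.mul_sum]
        refine Finset.sum_congr rfl fun χ _ ↦ ?_
        simp only [apply_div, map_mul, map_pow, MulChar.mul_apply,
          MulChar.pow_apply' _ two_ne_zero, MulChar.inv_apply_eq_inv', inv_pow]
        ring
  rw [Finset.mul_sum]
  simp_rw [h1]
  rw [Finset.sum_comm]
  refine Finset.sum_congr rfl fun χ _ ↦ ?_
  have h2 : (η * χ) (-1) = (η⁻¹ * χ) (-1) := by
    rw [MulChar.mul_apply, MulChar.mul_apply, inv_apply_neg_one]
  have h3 : ∑ x, (η⁻¹ * χ) x * (C⁻¹ * (χ⁻¹) ^ 2) (1 + x) =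
      (η * χ) (-1) * jacobiSum (η⁻¹ * χ) (C⁻¹ * (χ⁻¹) ^ 2) := by
    rw [h2, jacobiSum, Finset.mul_sum, ← Equiv.sum_comp (Equiv.neg F)]
    refine Finset.sum_congr rfl fun x _ ↦ ?_
    rw [← mul_assoc, ← map_mul, Equiv.neg_apply, neg_one_mul, sub_eq_add_neg]
  rw [← Finset.mul_sum, ← Finset.mul_sum, h3, mul_assoc (χ 4)]

/-- Pfaff's transformation at the argument `-4x/(1-x)²`, including the points `x = ±1`. -/
theorem P21_pfaff_quadratic [DecidableEq F] (hF : ringChar F ≠ 2) (B D : MulChar F ℂ) (x : F) :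
    (D ^ 2)⁻¹ (1 - x) * P21 (D * phi F * B⁻¹) D (D ^ 2 * B⁻¹) (-4 * x / (1 - x) ^ 2) =
      (D ^ 2)⁻¹ (1 + x) * P21 (D * phi F) D (D ^ 2 * B⁻¹) (4 * x / (1 + x) ^ 2)
        - delta (1 - x) * (D⁻¹ 4 * jacobiSum D (phi F * B⁻¹))
        + delta (1 + x) * (D⁻¹ 4 * jacobiSum D (phi F)) := by
  have h2 : (2 : F) ≠ 0 := Ring.two_ne_zero hF
  have h4 := four_ne_zero_of_ringChar hF
  have hD4 : (D ^ 2)⁻¹ 2 = D⁻¹ 4 := by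
    rw [← inv_pow, MulChar.pow_apply' _ two_ne_zero, ← map_pow]
    norm_num
  -- The left side vanishes here, while ₂ℙ₁ on the right has argument 1 and is a Jacobi sum; the δ
  -- term removes it.
  by_cases hx1 : x = 1
  · subst hx1
    have e1 : (1 : F) + 1 = 2 := by norm_num
    have e2 : (4 : F) * 1 / 2 ^ 2 = 1 := by
      rw [mul_one, show (2 : F) ^ 2 = 4 by norm_num, div_self h4]
    have e3 : D⁻¹ * (D ^ 2 * B⁻¹) * (D * phi F)⁻¹ = phi F * B⁻¹ := by
      rw [mul_inv, phi_inv, sq]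
      apply Additive.ofMul.injective
      simp only [ofMul_mul, ofMul_inv]
      abel
    rw [e1, e2, P21_one, e3, hD4]
    simp [delta, h2, MulChar.map_zero]
  -- The roles are exchanged: now the right-hand prefactor vanishes and the left argument is 1.
  by_cases hx2 : x = -1
  · subst hx2
    have e1 : (1 : F) - -1 = 2 := by norm_num
    have e2 : (-4 : F) * -1 / 2 ^ 2 = 1 := by
      rw [neg_mul_neg, mul_one, show (2 : F) ^ 2 = 4 by norm_num, div_self h4]
    have e3 : D⁻¹ * (D ^ 2 * B⁻¹) * (D * phi F * B⁻¹)⁻¹ = phi F := by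
      rw [mul_inv, mul_inv, inv_inv, phi_inv, sq]
      apply Additive.ofMul.injective
      simp only [ofMul_mul, ofMul_inv]
      abel
    rw [e1, e2, P21_one, e3, hD4]
    simp [delta, h2, MulChar.map_zero]
  have n1 : 1 - x ≠ 0 := sub_ne_zero.mpr (Ne.symm hx1)
  have n2 : 1 + x ≠ 0 := fun h ↦ hx2 (eq_neg_of_add_eq_zero_right h)
  have hl : 1 - -4 * x / (1 - x) ^ 2 = (1 + x) ^ 2 / (1 - x) ^ 2 := by
    field_simp
    ring
  have hl0 : (1 + x) ^ 2 / (1 - x) ^ 2 ≠ 0 := div_ne_zero (pow_ne_zero _ n2) (pow_ne_zero _ n1)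
  have hl1 : -4 * x / (1 - x) ^ 2 ≠ 1 := fun h ↦ by
    rw [h, sub_self] at hl
    exact hl0 hl.symm
  have hmu : -4 * x / (1 - x) ^ 2 / (-4 * x / (1 - x) ^ 2 - 1) = 4 * x / (1 + x) ^ 2 := by
    rw [← neg_sub 1, hl]
    field_simp
  have e3 : D ^ 2 * B⁻¹ * (D * phi F * B⁻¹)⁻¹ = D * phi F := by
    rw [mul_inv, mul_inv, inv_inv, phi_inv, sq]
    apply Additive.ofMul.injective
    simp only [ofMul_mul, ofMul_inv]
    abel
  rw [P21_pfaff _ _ _ hl1, hl, hmu, e3, ← mul_assoc]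
  have e4 : (D ^ 2)⁻¹ (1 - x) * D⁻¹ ((1 + x) ^ 2 / (1 - x) ^ 2) = (D ^ 2)⁻¹ (1 + x) := by
    have := apply_ne_zero D n1
    simp only [apply_div, MulChar.inv_apply_eq_inv', MulChar.pow_apply' _ two_ne_zero, map_pow]
    field_simp
  rw [e4]
  simp [delta, n1, n2]

end FFHyp

namespace FFHyp

variable {F : Type*} [Field F] [Fintype F]

/-! ### Products of Jacobi sums occurring in the quadratic transformation -/

theorem jacobiSum_one_right [DecidableEq (MulChar F ℂ)] (a : MulChar F ℂ) :
    jacobiSum a 1 = -1 + if a = 1 then (Fintype.card F : ℂ) - 1 else 0 := by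
  rw [jacobiSum_comm]
  split_ifs with h
  · rw [h, jacobiSum_one_one]
    ring
  · rw [jacobiSum_one_nontrivial h, add_zero]

theorem gaussSum_mul_inv_eq [DecidableEq (MulChar F ℂ)] {ψ : AddChar F ℂ} (hψ : ψ.IsPrimitive)
    (a : MulChar F ℂ) :
    gaussSum a ψ * gaussSum a⁻¹ ψ =
      Fintype.card F * a (-1) - if a = 1 then (Fintype.card F : ℂ) - 1 else 0 := by
  split_ifs with h
  · rw [h, inv_one, gaussSum_one hψ, MulChar.one_apply (by simp)]
    ring
  · rw [gaussSum_mul_inv hψ h, sub_zero]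

theorem card_mul_jacobiSum_mul_inv {ψ : AddChar F ℂ} (hψ : ψ.IsPrimitive)
    {B D : MulChar F ℂ} (hBD : B ≠ D) :
    Fintype.card F * jacobiSum D (D * B⁻¹) =
      B (-1) * gaussSum D ψ * gaussSum (D * B⁻¹) ψ * gaussSum ((D ^ 2)⁻¹ * B) ψ := by
  rw [card_mul_jacobiSum hψ (c := (D ^ 2)⁻¹ * B)
    (by
      apply Additive.ofMul.injective
      simp only [ofMul_mul, ofMul_inv, ofMul_pow, ofMul_one]
      abel)
    (fun h ↦ hBD (mul_inv_eq_one.mp h.2).symm), MulChar.mul_apply, inv_apply_neg_one,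
    MulChar.pow_apply' _ two_ne_zero, sq (D (-1)), apply_neg_one_sq, one_mul]

variable [DecidableEq F]

theorem phi_apply_four (hF : ringChar F ≠ 2) : phi F 4 = 1 := by
  rw [show (4 : F) = 2 ^ 2 by norm_num, phi_apply_sq (Ring.two_ne_zero hF)]

theorem phi_mul_inv_ne_one {D : MulChar F ℂ} (hD : D ≠ phi F) : phi F * D⁻¹ ≠ 1 :=
  fun h ↦ hD (mul_inv_eq_one.mp h).symm

/-- The summand in the character expansion of the transform of `₂ℙ₁` at `4x/(1+x)²`. -/
def quadraticTerm (η B D χ : MulChar F ℂ) : ℂ :=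
  jacobiSum χ⁻¹ (phi F * D⁻¹) * jacobiSum (D * χ) (D * B⁻¹) *
    (χ 4 * (η * χ) (-1) * jacobiSum (η⁻¹ * χ) ((D ^ 2)⁻¹ * (χ⁻¹) ^ 2))

/-- The product of four Gauss sums to which Barnes' lemma applies. -/
def barnesTerm (ψ : AddChar F ℂ) (η B D χ : MulChar F ℂ) : ℂ :=
  gaussSum (η⁻¹ * χ) ψ * gaussSum (1 * χ⁻¹) ψ *
    (gaussSum ((D ^ 2)⁻¹ * B * χ⁻¹) ψ * gaussSum (η * D ^ 2 * χ) ψ)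

/-- The factor of `quadraticTerm` that does not depend on the summation variable. -/
def quadraticFactor (ψ : AddChar F ℂ) (B D : MulChar F ℂ) : ℂ :=
  phi F (-1) * D (-1) * B (-1) * D⁻¹ 4 * gaussSum (phi F * D⁻¹) ψ * gaussSum (D * B⁻¹) ψ *
    gaussSum (phi F) ψ

variable {ψ : AddChar F ℂ} {B D : MulChar F ℂ}

/-- Duplication at Dχ followed by reflection at (Dχ)² removes four of the nine Gauss sums at the
cost of g(φ), D⁻¹(4) and q. The factor χ(4) is absorbed by the duplication. -/
theorem quadraticTerm_generic (hF : ringChar F ≠ 2) (hψ : ψ.IsPrimitive) (hD : D ≠ phi F)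
    (η : MulChar F ℂ) {χ : MulChar F ℂ} (hχ : (D * χ) ^ 2 ≠ 1) :
    (Fintype.card F : ℂ) ^ 3 * quadraticTerm η B D χ =
      quadraticFactor ψ B D * (Fintype.card F * barnesTerm ψ η B D χ) := by
  have j1 := card_mul_jacobiSum hψ (a := χ⁻¹) (b := phi F * D⁻¹) (c := phi F * (D * χ))
    (by
      -- The relation φ² = 1 is split off first, since `abel` only knows the group axioms.
      refine Eq.trans ?_ (phi_mul_self (F := F))
      apply Additive.ofMul.injective
      simp only [ofMul_mul, ofMul_inv]
      abel)
    (fun h ↦ phi_mul_inv_ne_one hD h.2)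
  have j2 := card_mul_jacobiSum hψ (a := D * χ) (b := D * B⁻¹) (c := (D ^ 2)⁻¹ * B * χ⁻¹)
    (by
      apply Additive.ofMul.injective
      simp only [ofMul_mul, ofMul_inv, ofMul_pow, ofMul_one]
      abel)
    (fun h ↦ hχ (by rw [h.1, one_pow]))
  have e3 : (D ^ 2)⁻¹ * (χ⁻¹) ^ 2 = ((D * χ) ^ 2)⁻¹ := by rw [mul_pow, mul_inv, inv_pow]
  have j3 := card_mul_jacobiSum hψ (a := η⁻¹ * χ) (b := ((D * χ) ^ 2)⁻¹) (c := η * D ^ 2 * χ)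
    (by
      apply Additive.ofMul.injective
      simp only [ofMul_mul, ofMul_inv, ofMul_pow, ofMul_one]
      abel)
    (fun h ↦ hχ (inv_eq_one.mp h.2))
  have dup := gaussSum_duplication hF hψ (D * χ)
  have inv := gaussSum_mul_inv hψ hχ
  have sgn : ((D * χ) ^ 2) (-1) = 1 := by
    rw [MulChar.pow_apply' _ two_ne_zero, sq, apply_neg_one_sq]
  have d4 := inv_apply_mul_apply D (four_ne_zero_of_ringChar hF)
  have hS : (η * χ) (-1) * (phi F * (D * χ)) (-1) * ((D ^ 2)⁻¹ * B * χ⁻¹) (-1) *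
      (η * D ^ 2 * χ) (-1) = phi F (-1) * D (-1) * B (-1) := by
    simp only [MulChar.mul_apply, inv_apply_neg_one, MulChar.pow_apply' _ two_ne_zero]
    rcases apply_neg_one_eq η with h1 | h1 <;> rcases apply_neg_one_eq χ with h2 | h2 <;>
      rcases apply_neg_one_eq D with h3 | h3 <;> simp [h1, h2, h3]
  rw [sgn] at inv
  rw [MulChar.mul_apply] at dup
  unfold quadraticTerm barnesTerm quadraticFactor
  rw [e3, one_mul]
  calc _ = (Fintype.card F * jacobiSum χ⁻¹ (phi F * D⁻¹)) *
        (Fintype.card F * jacobiSum (D * χ) (D * B⁻¹)) *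
        (Fintype.card F * jacobiSum (η⁻¹ * χ) ((D * χ) ^ 2)⁻¹) * (χ 4 * (η * χ) (-1)) := by ring
    _ = _ := by
      rw [j1, j2, j3]
      set Y := gaussSum χ⁻¹ ψ * gaussSum (phi F * D⁻¹) ψ * gaussSum (D * B⁻¹) ψ *
        gaussSum ((D ^ 2)⁻¹ * B * χ⁻¹) ψ * gaussSum (η⁻¹ * χ) ψ * gaussSum (η * D ^ 2 * χ) ψ with hY
      set s := phi F (-1) * D (-1) * B (-1) with hs
      linear_combination (Y * gaussSum (phi F * (D * χ)) ψ * gaussSum (D * χ) ψ *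
        gaussSum ((D * χ) ^ 2)⁻¹ ψ) * (χ 4 * hS - s * χ 4 * d4) +
        s * D⁻¹ 4 * Y * gaussSum ((D * χ) ^ 2)⁻¹ ψ * dup +
        s * D⁻¹ 4 * Y * gaussSum (phi F) ψ * inv

/-- At χ = D⁻¹ reflection at (Dχ)² fails. The third Jacobi sum J((ηD)⁻¹, 1) and the pair
g((ηD)⁻¹)g(ηD) each carry an indicator of ηD = 1; these match, leaving one correction uniform in η.
-/
theorem quadraticTerm_inv (hψ : ψ.IsPrimitive) (hF : ringChar F ≠ 2) (hBD : B ≠ D)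
    (η : MulChar F ℂ) :
    (Fintype.card F : ℂ) ^ 3 * quadraticTerm η B D D⁻¹ =
      quadraticFactor ψ B D * (Fintype.card F * barnesTerm ψ η B D D⁻¹ -
        ((Fintype.card F : ℂ) - 1) * Fintype.card F *
          (η (-1) * D (-1) * gaussSum D ψ * gaussSum (D⁻¹ * B) ψ)) := by
  classical
  have hDB : D * B⁻¹ ≠ 1 := fun h ↦ hBD (mul_inv_eq_one.mp h).symm
  have j1 := card_mul_jacobiSum hψ (a := D) (b := phi F * D⁻¹) (c := phi F)
    (by
      refine Eq.trans ?_ (phi_mul_self (F := F))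
      apply Additive.ofMul.injective
      simp only [ofMul_mul, ofMul_inv]
      abel)
    (fun h ↦ phi_ne_one hF (by simpa [h.1] using h.2))
  have i1 := gaussSum_mul_inv hψ hDB
  have e1 : (D * B⁻¹)⁻¹ = D⁻¹ * B := by rw [mul_inv, inv_inv]
  have e2 : (D ^ 2)⁻¹ * (D⁻¹⁻¹) ^ 2 = 1 := by rw [inv_inv, inv_mul_cancel]
  have e3 : η⁻¹ * D⁻¹ = (η * D)⁻¹ := by rw [mul_inv]
  have e4 : (D ^ 2)⁻¹ * B * D⁻¹⁻¹ = D⁻¹ * B := by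
    apply Additive.ofMul.injective
    simp only [ofMul_mul, ofMul_inv, ofMul_pow]
    abel
  have e5 : η * D ^ 2 * D⁻¹ = η * D := by
    apply Additive.ofMul.injective
    simp only [ofMul_mul, ofMul_inv, ofMul_pow]
    abel
  have s1 : (η * D⁻¹) (-1) = (η * D) (-1) := by
    rw [MulChar.mul_apply, MulChar.mul_apply, inv_apply_neg_one]
  have g1 := gaussSum_mul_inv_eq hψ (η * D)
  have se : (η * D) (-1) * (if η * D = 1 then (Fintype.card F : ℂ) - 1 else 0) =
      if η * D = 1 then (Fintype.card F : ℂ) - 1 else 0 := by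
    split_ifs with h
    · rw [h, MulChar.one_apply (by simp), one_mul]
    · rw [mul_zero]
  have s2 : η (-1) * D (-1) = (η * D) (-1) := rfl
  have s3 : (D * B⁻¹) (-1) = D (-1) * B (-1) := by rw [MulChar.mul_apply, inv_apply_neg_one]
  have sD := apply_neg_one_sq D
  have sB := apply_neg_one_sq B
  rw [e1, s3] at i1
  unfold quadraticTerm barnesTerm quadraticFactor
  rw [e2, e3, e4, e5, inv_inv, one_mul, mul_inv_cancel, jacobiSum_one_nontrivial hDB,
    jacobiSum_one_right, s1, s2]
  simp only [inv_eq_one]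
  set e := (if η * D = 1 then (Fintype.card F : ℂ) - 1 else 0) with he
  set q := (Fintype.card F : ℂ) with hq
  set s := (η * D) (-1) with hs
  set f := phi F (-1) with hf
  linear_combination q ^ 2 * D⁻¹ 4 * (s - s * e) * j1 -
    q ^ 2 * f * D⁻¹ 4 * gaussSum D ψ * gaussSum (phi F * D⁻¹) ψ * gaussSum (phi F) ψ * se
    - f * D (-1) * B (-1) * D⁻¹ 4 * gaussSum (phi F * D⁻¹) ψ * gaussSum (phi F) ψ *
      gaussSum D ψ * q * (s - e) * i1
    - q ^ 2 * f * D⁻¹ 4 * gaussSum D ψ * gaussSum (phi F * D⁻¹) ψ * gaussSum (phi F) ψ *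
      (s - e) * (sD * B (-1) * B (-1) + sB)
    - f * D (-1) * B (-1) * D⁻¹ 4 * gaussSum (phi F * D⁻¹) ψ * gaussSum (phi F) ψ *
      gaussSum (D * B⁻¹) ψ * q * gaussSum D ψ * gaussSum (D⁻¹ * B) ψ * g1

/-- The other failure of reflection, with ηφD in the role of ηD. -/
theorem quadraticTerm_phi_mul_inv (hψ : ψ.IsPrimitive) (hF : ringChar F ≠ 2) (hD : D ≠ phi F)
    (η : MulChar F ℂ) :
    (Fintype.card F : ℂ) ^ 3 * quadraticTerm η B D (phi F * D⁻¹) =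
      quadraticFactor ψ B D * (Fintype.card F * barnesTerm ψ η B D (phi F * D⁻¹) -
        ((Fintype.card F : ℂ) - 1) * Fintype.card F *
          (η (-1) * phi F (-1) * D (-1) * gaussSum (phi F * D) ψ *
            gaussSum (phi F * D⁻¹ * B) ψ)) := by
  classical
  have hp := phi_inv (F := F)
  have j1 := card_mul_jacobiSum hψ (a := phi F * D) (b := phi F * D⁻¹) (c := 1)
    (by
      refine Eq.trans ?_ (phi_mul_self (F := F))
      apply Additive.ofMul.injective
      simp only [ofMul_mul, ofMul_inv, ofMul_one]
      abel)
    (fun h ↦ phi_mul_inv_ne_one hD h.2)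
  have j2 := card_mul_jacobiSum hψ (a := phi F) (b := D * B⁻¹) (c := phi F * D⁻¹ * B)
    (by
      refine Eq.trans ?_ (phi_mul_self (F := F))
      apply Additive.ofMul.injective
      simp only [ofMul_mul, ofMul_inv]
      abel)
    (fun h ↦ phi_ne_one hF h.1)
  have e0 : (phi F * D⁻¹)⁻¹ = phi F * D := by rw [mul_inv, hp, inv_inv]
  have e1 : D * (phi F * D⁻¹) = phi F := by
    apply Additive.ofMul.injective
    simp only [ofMul_mul, ofMul_inv]
    abel
  have e2 : (D ^ 2)⁻¹ * (phi F * D) ^ 2 = 1 := by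
    rw [mul_pow, sq (phi F), phi_mul_self, one_mul, inv_mul_cancel]
  have e3 : η⁻¹ * (phi F * D⁻¹) = (η * phi F * D)⁻¹ := by
    rw [mul_inv, mul_inv, hp, mul_assoc]
  have e4 : (D ^ 2)⁻¹ * B * (phi F * D) = phi F * D⁻¹ * B := by
    apply Additive.ofMul.injective
    simp only [ofMul_mul, ofMul_inv, ofMul_pow]
    abel
  have e5 : η * D ^ 2 * (phi F * D⁻¹) = η * phi F * D := by
    apply Additive.ofMul.injective
    simp only [ofMul_mul, ofMul_inv, ofMul_pow]
    abel
  have s1 : (η * (phi F * D⁻¹)) (-1) = (η * phi F * D) (-1) := by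
    simp only [MulChar.mul_apply, inv_apply_neg_one]
    ring
  have v4 : (phi F * D⁻¹) 4 = D⁻¹ 4 := by
    rw [MulChar.mul_apply, phi_apply_four hF, one_mul]
  have g1 := gaussSum_mul_inv_eq hψ (η * phi F * D)
  have se : (η * phi F * D) (-1) *
      (if η * phi F * D = 1 then (Fintype.card F : ℂ) - 1 else 0) =
      if η * phi F * D = 1 then (Fintype.card F : ℂ) - 1 else 0 := by
    split_ifs with h
    · rw [h, MulChar.one_apply (by simp), one_mul]
    · rw [mul_zero]
  have s2 : η (-1) * phi F (-1) * D (-1) = (η * phi F * D) (-1) := rfl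
  have s3 : (phi F * D⁻¹ * B) (-1) = phi F (-1) * D (-1) * B (-1) := by
    rw [MulChar.mul_apply, MulChar.mul_apply, inv_apply_neg_one]
  rw [s3] at j2
  rw [gaussSum_one hψ, MulChar.one_apply (by simp)] at j1
  unfold quadraticTerm barnesTerm quadraticFactor
  rw [e0, e1, e2, e3, e4, e5, one_mul, jacobiSum_one_right, s1, s2, v4]
  simp only [inv_eq_one]
  set e := (if η * phi F * D = 1 then (Fintype.card F : ℂ) - 1 else 0) with he
  set q := (Fintype.card F : ℂ) with hq
  set s := (η * phi F * D) (-1) with hs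
  set f := phi F (-1) * D (-1) * B (-1) with hf
  set P := f * D⁻¹ 4 * gaussSum (phi F * D⁻¹) ψ * gaussSum (D * B⁻¹) ψ * gaussSum (phi F) ψ *
    gaussSum (phi F * D) ψ * gaussSum (phi F * D⁻¹ * B) ψ with hP
  linear_combination q * D⁻¹ 4 * (-s + s * e) * (q * jacobiSum (phi F) (D * B⁻¹) * j1 -
    gaussSum (phi F * D) ψ * gaussSum (phi F * D⁻¹) ψ * j2) - P * q * se - P * q * g1

end FFHyp

/-! ### Summation over χ and evaluation of the constants -/

namespace FFHyp

variable {F : Type*} [Field F] [Fintype F] [DecidableEq F]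
variable {ψ : AddChar F ℂ} {B D : MulChar F ℂ}

theorem card_cube_mul_quadraticTerm [DecidableEq (MulChar F ℂ)] (hF : ringChar F ≠ 2)
    (hψ : ψ.IsPrimitive) (hD : D ≠ phi F) (hBD : B ≠ D) (η χ : MulChar F ℂ) :
    (Fintype.card F : ℂ) ^ 3 * quadraticTerm η B D χ =
      quadraticFactor ψ B D * (Fintype.card F * barnesTerm ψ η B D χ -
        (if χ = D⁻¹ then ((Fintype.card F : ℂ) - 1) * Fintype.card F *
          (η (-1) * D (-1) * gaussSum D ψ * gaussSum (D⁻¹ * B) ψ) else 0) -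
        (if χ = phi F * D⁻¹ then ((Fintype.card F : ℂ) - 1) * Fintype.card F *
          (η (-1) * phi F (-1) * D (-1) * gaussSum (phi F * D) ψ *
            gaussSum (phi F * D⁻¹ * B) ψ) else 0)) := by
  have hne : phi F * D⁻¹ ≠ D⁻¹ := fun h ↦ phi_ne_one hF (mul_eq_right.mp h)
  by_cases h1 : χ = D⁻¹
  · rw [h1, if_pos rfl, if_neg hne.symm, sub_zero, quadraticTerm_inv hψ hF hBD]
  by_cases h2 : χ = phi F * D⁻¹
  · rw [h2, if_pos rfl, if_neg hne, sub_zero, quadraticTerm_phi_mul_inv hψ hF hD]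
  rw [if_neg h1, if_neg h2, sub_zero, sub_zero]
  refine quadraticTerm_generic hF hψ hD η fun h ↦ ?_
  rcases (mulChar_sq_eq_one_iff hF).mp h with h | h
  · exact h1 (inv_eq_of_mul_eq_one_right h).symm
  · exact h2 (by rw [← h, mul_comm D, mul_inv_cancel_right])

/-- Barnes' lemma for the product of Gauss sums in the quadratic transformation. -/
theorem sum_barnesTerm (hψ : ψ.IsPrimitive) (hD : D ≠ phi F) (hBD : B ≠ D)
    (hF : ringChar F ≠ 2) (η : MulChar F ℂ) :
    gaussSum B⁻¹ ψ * ∑ χ, barnesTerm ψ η B D χ =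
      ((Fintype.card F : ℂ) - 1) * (Fintype.card F * B (-1) *
        (jacobiSum η⁻¹ B⁻¹ * jacobiSum (D ^ 2 * η) B⁻¹)) := by
  classical
  unfold barnesTerm
  rw [sum_gaussSum_mul]
  have e1 : η * D ^ 2 * 1 = D ^ 2 * η := by rw [mul_one, mul_comm]
  have e2 : η⁻¹ * (η * D ^ 2) * 1 * ((D ^ 2)⁻¹ * B) = B := by
    apply Additive.ofMul.injective
    simp only [ofMul_mul, ofMul_inv, ofMul_pow, ofMul_one]
    abel
  have e3 : η * D ^ 2 * ((D ^ 2)⁻¹ * B) = η * B := by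
    apply Additive.ofMul.injective
    simp only [ofMul_mul, ofMul_inv, ofMul_pow]
    abel
  have s1 : (D ^ 2 * η) (-1) = η (-1) := by
    rw [MulChar.mul_apply, MulChar.pow_apply' _ two_ne_zero, sq, apply_neg_one_sq, one_mul]
  rw [e1, e2, e3, mul_one, s1]
  have sη := apply_neg_one_sq η
  -- J(η⁻¹, B⁻¹) is then J(1,1), which has no Gauss-sum formula; this is exactly when Barnes' lemma
  -- has its extra term.
  by_cases h : η = 1 ∧ B = 1
  · obtain ⟨rfl, rfl⟩ := h
    have hD2 : D ^ 2 ≠ 1 := fun h ↦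
      ((mulChar_sq_eq_one_iff hF).mp h).elim (fun h ↦ hBD h.symm) hD
    simp only [inv_one, mul_one, and_self, if_true, gaussSum_one hψ, jacobiSum_one_one,
      jacobiSum_one_right, if_neg hD2, MulChar.one_apply (isUnit_one.neg : IsUnit (-1 : F))]
    ring
  · have h' : ¬(η⁻¹ = 1 ∧ η * B = 1) := fun h2 ↦
      h ⟨inv_eq_one.mp h2.1, by simpa [inv_eq_one.mp h2.1] using h2.2⟩
    have j := card_mul_jacobiSum hψ (a := η⁻¹) (b := B⁻¹) (c := η * B)
      (by
        apply Additive.ofMul.injective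
        simp only [ofMul_mul, ofMul_inv, ofMul_one]
        abel)
      (fun h2 ↦ h ⟨inv_eq_one.mp h2.1, inv_eq_one.mp h2.2⟩)
    rw [MulChar.mul_apply] at j
    rw [if_neg h', add_zero]
    have sB := apply_neg_one_sq B
    linear_combination -((Fintype.card F : ℂ) - 1) * jacobiSum (D ^ 2 * η) B⁻¹ * B (-1) * j -
      ((Fintype.card F : ℂ) - 1) * jacobiSum (D ^ 2 * η) B⁻¹ * η (-1) * gaussSum η⁻¹ ψ *
        gaussSum B⁻¹ ψ * gaussSum (η * B) ψ * sB

theorem sq_and_inv_ne_one (hF : ringChar F ≠ 2) (hD : D ≠ phi F) (hBD : B ≠ D) :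
    ¬(D ^ 2 = 1 ∧ B⁻¹ = 1) := fun h ↦
  ((mulChar_sq_eq_one_iff hF).mp h.1).elim (fun h1 ↦ hBD (by rw [h1, inv_eq_one.mp h.2])) hD

theorem card_mul_jacobiSum_sq_inv (hF : ringChar F ≠ 2) (hψ : ψ.IsPrimitive) (hD : D ≠ phi F)
    (hBD : B ≠ D) :
    Fintype.card F * jacobiSum (D ^ 2) B⁻¹ =
      B (-1) * gaussSum (D ^ 2) ψ * gaussSum B⁻¹ ψ * gaussSum ((D ^ 2)⁻¹ * B) ψ := by
  rw [card_mul_jacobiSum hψ (c := (D ^ 2)⁻¹ * B)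
    (by
      apply Additive.ofMul.injective
      simp only [ofMul_mul, ofMul_inv, ofMul_pow, ofMul_one]
      abel)
    (sq_and_inv_ne_one hF hD hBD), MulChar.mul_apply, inv_apply_neg_one,
    MulChar.pow_apply' _ two_ne_zero, sq (D (-1)), apply_neg_one_sq, one_mul]

/-- Constant of the main term: duplication at D turns g(D²)g(φ) into g(D)g(φD), and reflection pairs
g(φD) with g(φD⁻¹). -/
theorem jacobiSum_mul_quadraticFactor (hF : ringChar F ≠ 2) (hψ : ψ.IsPrimitive)
    (hD : D ≠ phi F) (hBD : B ≠ D) :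
    jacobiSum (D ^ 2) B⁻¹ * quadraticFactor ψ B D =
      Fintype.card F * B (-1) * gaussSum B⁻¹ ψ * jacobiSum D (D * B⁻¹) := by
  have jC := card_mul_jacobiSum_sq_inv hF hψ hD hBD
  have jD := card_mul_jacobiSum_mul_inv hψ hBD
  have dup := gaussSum_duplication hF hψ D
  have d4 := inv_apply_mul_apply D (four_ne_zero_of_ringChar hF)
  have i1 := gaussSum_mul_inv hψ (phi_mul_inv_ne_one hD)
  rw [mul_inv, phi_inv, inv_inv, MulChar.mul_apply, inv_apply_neg_one] at i1
  have sD := apply_neg_one_sq D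
  have sB := apply_neg_one_sq B
  have sf := apply_neg_one_sq (phi F)
  refine mul_left_cancel₀ (card_cast_ne_zero (F := F)) ?_
  unfold quadraticFactor
  set q := (Fintype.card F : ℂ) with hq
  set Z := gaussSum B⁻¹ ψ * gaussSum ((D ^ 2)⁻¹ * B) ψ * gaussSum (D * B⁻¹) ψ with hZ
  set f := phi F (-1) with hf
  linear_combination f * D (-1) * B (-1) * D⁻¹ 4 * gaussSum (phi F * D⁻¹) ψ *
      gaussSum (D * B⁻¹) ψ * gaussSum (phi F) ψ * jC
    - q * B (-1) * gaussSum B⁻¹ ψ * jD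
    - f * D (-1) * B (-1) * B (-1) * Z * gaussSum (phi F * D⁻¹) ψ * D⁻¹ 4 * dup
    + f * D (-1) * B (-1) * B (-1) * Z * gaussSum (phi F * D⁻¹) ψ *
      gaussSum D ψ * gaussSum (phi F * D) ψ * d4
    + f * D (-1) * B (-1) * B (-1) * Z * gaussSum D ψ * i1
    + q * B (-1) * B (-1) * Z * gaussSum D ψ * (D (-1) * D (-1) * sf + sD)

/-- Identifies the defect at χ = D⁻¹ with Pfaff's correction at x = -1. -/
theorem quadraticFactor_mul_gaussSum (hF : ringChar F ≠ 2) (hψ : ψ.IsPrimitive)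
    (hBD : B ≠ D) :
    quadraticFactor ψ B D * (D (-1) * gaussSum D ψ * gaussSum (D⁻¹ * B) ψ) =
      (Fintype.card F : ℂ) ^ 2 * (D⁻¹ 4 * jacobiSum D (phi F)) := by
  have hDB : D * B⁻¹ ≠ 1 := fun h ↦ hBD (mul_inv_eq_one.mp h).symm
  have j := card_mul_jacobiSum hψ (a := D) (b := phi F) (c := phi F * D⁻¹)
    (by
      refine Eq.trans ?_ (phi_mul_self (F := F))
      apply Additive.ofMul.injective
      simp only [ofMul_mul, ofMul_inv]
      abel)
    (fun h ↦ phi_ne_one hF h.2)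
  have i1 := gaussSum_mul_inv hψ hDB
  rw [mul_inv, inv_inv, MulChar.mul_apply, inv_apply_neg_one] at i1
  rw [MulChar.mul_apply, inv_apply_neg_one] at j
  have sD := apply_neg_one_sq D
  have sB := apply_neg_one_sq B
  unfold quadraticFactor
  set q := (Fintype.card F : ℂ) with hq
  set f := phi F (-1) with hf
  set Z := gaussSum (phi F * D⁻¹) ψ * gaussSum (phi F) ψ * gaussSum D ψ with hZ
  linear_combination f * D (-1) * B (-1) * D⁻¹ 4 * Z * D (-1) * i1
    + f * D⁻¹ 4 * Z * D (-1) * q * (D (-1) * D (-1) * sB + sD) - q * D⁻¹ 4 * j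

/-- Turns the defect at χ = φD⁻¹ into the coefficient of δ(1+x). -/
theorem gaussSum_mul_eq_jacobiSum (hψ : ψ.IsPrimitive) (hD : D ≠ phi F) :
    B (-1) * gaussSum B⁻¹ ψ * (phi F (-1) * D (-1) * gaussSum (phi F * D) ψ *
      gaussSum (phi F * D⁻¹ * B) ψ) = Fintype.card F * jacobiSum B⁻¹ (D * phi F) := by
  rw [mul_comm D, card_mul_jacobiSum hψ (c := phi F * D⁻¹ * B)
    (by
      refine Eq.trans ?_ (phi_mul_self (F := F))
      apply Additive.ofMul.injective
      simp only [ofMul_mul, ofMul_inv]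
      abel)
    (fun h ↦ hD (by
      have := (inv_eq_of_mul_eq_one_right h.2).symm
      rwa [phi_inv] at this)),
    MulChar.mul_apply, MulChar.mul_apply, inv_apply_neg_one]
  ring

/-- Turns Pfaff's correction at x = 1 into the coefficient of δ(1-x), by duplication at B⁻¹ and at
D⁻¹B. -/
theorem jacobiSum_mul_jacobiSum_phi (hF : ringChar F ≠ 2) (hψ : ψ.IsPrimitive) (hD : D ≠ phi F)
    (hBD : B ≠ D) :
    jacobiSum (D ^ 2) B⁻¹ * (D⁻¹ 4 * jacobiSum D (phi F * B⁻¹)) =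
      jacobiSum D (D * B⁻¹) * jacobiSum (D ^ 2) (B⁻¹ ^ 2) := by
  -- Both sides then contain J(1,1) and agree without Gauss sums.
  by_cases h : D = 1 ∧ phi F * B⁻¹ = 1
  · obtain ⟨rfl, h⟩ := h
    have hB : B = phi F := (mul_inv_eq_one.mp h).symm
    rw [h, hB, one_pow, one_mul, phi_inv, sq, phi_mul_self, inv_one,
      MulChar.one_apply (four_ne_zero_of_ringChar hF).isUnit, one_mul]
  have h' : ¬(D ^ 2 = 1 ∧ B⁻¹ ^ 2 = 1) := fun h2 ↦ by
    have hD1 := ((mulChar_sq_eq_one_iff hF).mp h2.1).resolve_right hD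
    rcases (mulChar_sq_eq_one_iff hF).mp h2.2 with h3 | h3
    · exact hBD (by rw [hD1, inv_eq_one.mp h3])
    · exact h ⟨hD1, by rw [h3, phi_mul_self]⟩
  have hDB : D * B⁻¹ ≠ 1 := fun h ↦ hBD (mul_inv_eq_one.mp h).symm
  have jC := card_mul_jacobiSum_sq_inv hF hψ hD hBD
  have jD := card_mul_jacobiSum_mul_inv hψ hBD
  have j1 := card_mul_jacobiSum hψ (c := phi F * (D⁻¹ * B))
    (by
      refine Eq.trans ?_ (phi_mul_self (F := F))
      apply Additive.ofMul.injective
      simp only [ofMul_mul, ofMul_inv]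
      abel) h
  have j2 := card_mul_jacobiSum hψ (c := (D⁻¹ * B) ^ 2)
    (by
      apply Additive.ofMul.injective
      simp only [ofMul_mul, ofMul_inv, ofMul_pow, ofMul_one]
      abel) h'
  have dupB := gaussSum_duplication hF hψ B⁻¹
  have dupDB := gaussSum_duplication hF hψ (D⁻¹ * B)
  have b4 := inv_apply_mul_apply B (four_ne_zero_of_ringChar hF)
  have i1 := gaussSum_mul_inv hψ hDB
  have i2 := gaussSum_mul_inv hψ (phi_ne_one hF)
  rw [phi_inv] at i2
  rw [mul_inv, inv_inv, MulChar.mul_apply, inv_apply_neg_one] at i1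
  rw [MulChar.mul_apply, MulChar.mul_apply, inv_apply_neg_one] at j1
  rw [MulChar.pow_apply' _ two_ne_zero, sq ((D⁻¹ * B) (-1)), apply_neg_one_sq, one_mul] at j2
  rw [MulChar.mul_apply] at dupDB
  have sf := apply_neg_one_sq (phi F)
  have hq0 := card_cast_ne_zero (F := F)
  -- The extra g(D⁻¹B) supplies the partner for duplication at D⁻¹B and for reflection against
  -- g(DB⁻¹).
  refine mul_left_cancel₀ hq0 (mul_left_cancel₀ hq0
    (mul_left_cancel₀ (gaussSum_ne_zero hψ (D⁻¹ * B)) ?_))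
  set q := (Fintype.card F : ℂ) with hq
  set f := phi F (-1) with hf
  set y := D⁻¹ * B with hy
  have key : gaussSum y ψ * (D⁻¹ 4 * f * D (-1) * B (-1) * gaussSum B⁻¹ ψ *
      gaussSum (phi F * B⁻¹) ψ * gaussSum (phi F * y) ψ) =
      gaussSum y ψ * (gaussSum (D * B⁻¹) ψ * gaussSum (B⁻¹ ^ 2) ψ * gaussSum (y ^ 2) ψ) := by
    linear_combination -f * D (-1) * B (-1) * D⁻¹ 4 * gaussSum B⁻¹ ψ *
        gaussSum (phi F * B⁻¹) ψ * gaussSum y ψ * gaussSum (phi F * y) ψ * b4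
      + f * D (-1) * B (-1) * D⁻¹ 4 * B 4 * gaussSum y ψ * gaussSum (phi F * y) ψ * dupB
      + f * D (-1) * B (-1) * gaussSum (B⁻¹ ^ 2) ψ * gaussSum (phi F) ψ * dupDB
      + f * D (-1) * B (-1) * gaussSum (B⁻¹ ^ 2) ψ * gaussSum (y ^ 2) ψ * i2
      + q * D (-1) * B (-1) * gaussSum (B⁻¹ ^ 2) ψ * gaussSum (y ^ 2) ψ * sf
      - gaussSum (B⁻¹ ^ 2) ψ * gaussSum (y ^ 2) ψ * i1
  calc _ = gaussSum y ψ * ((q * jacobiSum (D ^ 2) B⁻¹) * D⁻¹ 4 *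
        (q * jacobiSum D (phi F * B⁻¹))) := by ring
    _ = gaussSum y ψ * ((q * jacobiSum D (D * B⁻¹)) *
        (q * jacobiSum (D ^ 2) (B⁻¹ ^ 2))) := by
      rw [jC, jD, j1, j2]
      linear_combination B (-1) * gaussSum D ψ * gaussSum (D ^ 2) ψ *
        gaussSum ((D ^ 2)⁻¹ * B) ψ * key
    _ = _ := by ring

end FFHyp

/-! ### Comparison of Mellin transforms -/

namespace FFHyp

variable {F : Type*} [Field F] [Fintype F] [DecidableEq F] {B D : MulChar F ℂ}

theorem mellin_P21_comp_quadratic (hF : ringChar F ≠ 2) (η B D : MulChar F ℂ) :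
    ((Fintype.card F : ℂ) - 1) * ∑ x, η⁻¹ x * ((D ^ 2)⁻¹ (1 + x) *
        P21 (D * phi F) D (D ^ 2 * B⁻¹) (4 * x / (1 + x) ^ 2)) =
      ∑ χ, quadraticTerm η B D χ := by
  have e1 : (D * phi F)⁻¹ = phi F * D⁻¹ := by rw [mul_inv, phi_inv, mul_comm]
  have e2 : D⁻¹ * (D ^ 2 * B⁻¹) = D * B⁻¹ := by rw [sq, ← mul_assoc, inv_mul_cancel_left]
  rw [mellin_comp_quadratic hF]
  simp_rw [mellin_P21, e1, e2, quadraticTerm]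

/-- The multiplicative Fourier transform of the quadratic transformation. -/
theorem mellin_quadratic_transformation (hF : ringChar F ≠ 2) (hD : D ≠ phi F) (hBD : B ≠ D)
    (η : MulChar F ℂ) :
    jacobiSum (D ^ 2) B⁻¹ * (∑ x, η⁻¹ x * ((D ^ 2)⁻¹ (1 + x) *
          P21 (D * phi F) D (D ^ 2 * B⁻¹) (4 * x / (1 + x) ^ 2))
        - D⁻¹ 4 * jacobiSum D (phi F * B⁻¹) + η (-1) * (D⁻¹ 4 * jacobiSum D (phi F))) =
      jacobiSum D (D * B⁻¹) * (jacobiSum η⁻¹ B⁻¹ * jacobiSum (D ^ 2 * η) B⁻¹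
        - jacobiSum (D ^ 2) (B⁻¹ ^ 2) - η (-1) * jacobiSum B⁻¹ (D * phi F)) := by
  classical
  obtain ⟨ψ, hψ⟩ := exists_primitive_addChar (F := F)
  set T := ∑ x, η⁻¹ x * ((D ^ 2)⁻¹ (1 + x) *
    P21 (D * phi F) D (D ^ 2 * B⁻¹) (4 * x / (1 + x) ^ 2)) with hT
  have hT1 : ((Fintype.card F : ℂ) - 1) * T = _ := mellin_P21_comp_quadratic hF η B D
  have hsum : (Fintype.card F : ℂ) ^ 3 * ∑ χ, quadraticTerm η B D χ =
      quadraticFactor ψ B D * (Fintype.card F * ∑ χ, barnesTerm ψ η B D χ -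
        ((Fintype.card F : ℂ) - 1) * Fintype.card F *
          (η (-1) * D (-1) * gaussSum D ψ * gaussSum (D⁻¹ * B) ψ) -
        ((Fintype.card F : ℂ) - 1) * Fintype.card F *
          (η (-1) * phi F (-1) * D (-1) * gaussSum (phi F * D) ψ *
            gaussSum (phi F * D⁻¹ * B) ψ)) := by
    rw [Finset.mul_sum]
    simp_rw [card_cube_mul_quadraticTerm hF hψ hD hBD]
    rw [← Finset.mul_sum, Finset.sum_sub_distrib, Finset.sum_sub_distrib, Finset.sum_ite_eq',
      Finset.sum_ite_eq', if_pos (Finset.mem_univ _), if_pos (Finset.mem_univ _),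
      ← Finset.mul_sum]
  have hb := sum_barnesTerm hψ hD hBD hF η
  have h1 := jacobiSum_mul_quadraticFactor hF hψ hD hBD
  have h2 := quadraticFactor_mul_gaussSum hF hψ hBD
  have h3 := gaussSum_mul_eq_jacobiSum (B := B) hψ hD
  have h4 := jacobiSum_mul_jacobiSum_phi hF hψ hD hBD
  have sB := apply_neg_one_sq B
  have hq0 := card_cast_ne_zero (F := F)
  refine mul_left_cancel₀ (card_sub_one_ne_zero (F := F))
    (mul_left_cancel₀ (pow_ne_zero 3 hq0) ?_)
  rw [← hT1] at hsum
  set q := (Fintype.card F : ℂ) with hq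
  set K := quadraticFactor ψ B D with hK
  set J := jacobiSum (D ^ 2) B⁻¹ with hJ
  set J' := jacobiSum D (D * B⁻¹) with hJ'
  set S := ∑ χ, barnesTerm ψ η B D χ with hS
  -- `h1` with `hb` gives the main term, `h2` cancels Pfaff's correction at -1, `h1` with `h3` gives
  -- the δ(1+x) term, and `h4` the δ(1-x) term.
  linear_combination J * hsum + q * S * h1 + q ^ 2 * B (-1) * J' * hb
    + q ^ 3 * (q - 1) * J' * jacobiSum η⁻¹ B⁻¹ * jacobiSum (D ^ 2 * η) B⁻¹ * sB
    - (q - 1) * q * J * η (-1) * h2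
    - (q - 1) * q * (η (-1) * phi F (-1) * D (-1) * gaussSum (phi F * D) ψ *
            gaussSum (phi F * D⁻¹ * B) ψ) * h1
    - (q - 1) * q ^ 2 * J' * η (-1) * h3 - (q - 1) * q ^ 3 * h4

theorem sum_mul_delta_one_sub (f : F → ℂ) (c : ℂ) :
    ∑ x, f x * (delta (1 - x) * c) = f 1 * c := by
  rw [Finset.sum_eq_single 1]
  · simp [delta]
  · intro x _ hx
    simp [delta, sub_eq_zero, hx.symm]
  · simp

theorem sum_mul_delta_one_add (f : F → ℂ) (c : ℂ) :
    ∑ x, f x * (delta (1 + x) * c) = f (-1) * c := by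
  rw [Finset.sum_eq_single (-1)]
  · simp [delta]
  · intro x _ hx
    have : 1 + x ≠ 0 := fun h ↦ hx (eq_neg_of_add_eq_zero_right h)
    simp [delta, this]
  · simp

/-- The quadratic transformation for the period functions, at nonzero arguments. -/
theorem P21_quadratic_transformation (hF : ringChar F ≠ 2) (hD : D ≠ phi F) (hBD : B ≠ D)
    {x : F} (hx : x ≠ 0) :
    jacobiSum (D ^ 2) B⁻¹ * ((D ^ 2)⁻¹ (1 - x) *
        P21 (D * phi F * B⁻¹) D (D ^ 2 * B⁻¹) (-4 * x / (1 - x) ^ 2)) =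
      jacobiSum D (D * B⁻¹) * (P21 B (D ^ 2) (D ^ 2 * B⁻¹) x
        - delta (1 - x) * jacobiSum (D ^ 2) (B⁻¹ ^ 2)
        - delta (1 + x) * jacobiSum B⁻¹ (D * phi F)) := by
  rw [← sub_eq_zero]
  refine eq_zero_of_mellin_eq_zero (fun x ↦ jacobiSum (D ^ 2) B⁻¹ * ((D ^ 2)⁻¹ (1 - x) *
        P21 (D * phi F * B⁻¹) D (D ^ 2 * B⁻¹) (-4 * x / (1 - x) ^ 2)) -
      jacobiSum D (D * B⁻¹) * (P21 B (D ^ 2) (D ^ 2 * B⁻¹) x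
        - delta (1 - x) * jacobiSum (D ^ 2) (B⁻¹ ^ 2)
        - delta (1 + x) * jacobiSum B⁻¹ (D * phi F))) (fun η ↦ ?_) hx
  have h := mellin_quadratic_transformation hF hD hBD η
  have hP := mellin_P21 B (D ^ 2) (D ^ 2 * B⁻¹) η
  rw [inv_mul_cancel_left] at hP
  have dsub (c : ℂ) : ∑ x, η⁻¹ x * (delta (1 - x) * c) = c := by
    rw [sum_mul_delta_one_sub (fun x ↦ η⁻¹ x), MulChar.map_one, one_mul]
  have dadd (c : ℂ) : ∑ x, η⁻¹ x * (delta (1 + x) * c) = η (-1) * c := by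
    rw [sum_mul_delta_one_add (fun x ↦ η⁻¹ x), inv_apply_neg_one]
  simp_rw [P21_pfaff_quadratic hF]
  calc _ = jacobiSum (D ^ 2) B⁻¹ * (∑ x, η⁻¹ x * ((D ^ 2)⁻¹ (1 + x) *
          P21 (D * phi F) D (D ^ 2 * B⁻¹) (4 * x / (1 + x) ^ 2))
        - ∑ x, η⁻¹ x * (delta (1 - x) * (D⁻¹ 4 * jacobiSum D (phi F * B⁻¹)))
        + ∑ x, η⁻¹ x * (delta (1 + x) * (D⁻¹ 4 * jacobiSum D (phi F)))) -
      jacobiSum D (D * B⁻¹) * (∑ x, η⁻¹ x * P21 B (D ^ 2) (D ^ 2 * B⁻¹) x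
        - ∑ x, η⁻¹ x * (delta (1 - x) * jacobiSum (D ^ 2) (B⁻¹ ^ 2))
        - ∑ x, η⁻¹ x * (delta (1 + x) * jacobiSum B⁻¹ (D * phi F))) := by
        rw [← Finset.sum_sub_distrib, ← Finset.sum_add_distrib, ← Finset.sum_sub_distrib,
          ← Finset.sum_sub_distrib, Finset.mul_sum, Finset.mul_sum, ← Finset.sum_sub_distrib]
        exact Finset.sum_congr rfl fun x _ ↦ by ring
    _ = 0 := by
        rw [dsub, dadd, dsub, dadd, hP, h, sub_self]

end FFHyp

end

theorem mainTheorem2 {F : Type*} [Field F] [Fintype F] [DecidableEq F]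
    (hF : ringChar F ≠ 2) (B C D : MulChar F ℂ) (hC : C = D ^ 2)
    (hD : D ≠ FFHyp.phi F) (hBD : B ≠ D) (x : F) :
    C⁻¹ (1 - x) *
        FFHyp.F21 (D * FFHyp.phi F * B⁻¹) D (C * B⁻¹) (-4 * x / (1 - x) ^ 2) =
      FFHyp.F21 B C (C * B⁻¹) x
        - FFHyp.delta (1 - x) * (jacobiSum C (B⁻¹ ^ 2) / jacobiSum C B⁻¹)
        - FFHyp.delta (1 + x) * (jacobiSum B⁻¹ (D * FFHyp.phi F) / jacobiSum C B⁻¹) := by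
  subst hC
  have e1 : D ^ 2 * B⁻¹ * D⁻¹ = D * B⁻¹ := by
    rw [sq, mul_right_comm, mul_inv_cancel_right]
  have e2 : D ^ 2 * B⁻¹ * (D ^ 2)⁻¹ = B⁻¹ := by
    rw [mul_comm, inv_mul_cancel_left]
  have n1 := FFHyp.jacobiSum_ne_zero (FFHyp.card_ne_two hF) D (D * B⁻¹)
  have n2 := FFHyp.jacobiSum_ne_zero (FFHyp.card_ne_two hF) (D ^ 2) B⁻¹
  unfold FFHyp.F21
  rw [e1, e2]
  -- Both normalized series equal 1 at argument 0, and both δ terms vanish.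
  by_cases hx : x = 0
  · subst hx
    have e3 : D⁻¹ * (D ^ 2 * B⁻¹) = D * B⁻¹ := by rw [mul_comm, e1]
    rw [mul_zero, zero_div, FFHyp.P21_zero, FFHyp.P21_zero, e3, inv_mul_cancel_left,
      one_div_mul_cancel n1, one_div_mul_cancel n2]
    simp [FFHyp.delta]
  · have h := FFHyp.P21_quadratic_transformation hF hD hBD hx
    generalize -4 * x / (1 - x) ^ 2 = l at h ⊢
    field_simp
    linear_combination h
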